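/- Let $M$ be a smooth manifold and $G$ a connected Lie group with Lie algebra $\mathfrak g$ (both finite-dimensional and without boundary), and let $G$ act on $Q=M\times G$ by $g\cdot(m,k)=(m,gk)$, with lifted action on $T^*Q$ and momentum map $J:T^*Q\to\mathfrak g^*$, $J(\alpha_q)(\xi)=\alpha_q(\xi_Q(q))$, where $\xi_Q$ is the infinitesimal generator of $\xi\in\mathfrak g$. Identify $T^*Q=T^*M\times G\times\mathfrak g^*$ by trivializing $T^*G$ on the left. Let $h:T^*Q\to\mathbb R$ be a smooth $G$-invariant Hamiltonian, let $\mu\in\mathfrak g^*$ be a fixed point of the coadjoint action, and let $\tilde h_\mu:T^*M\to\mathbb R$, $\tilde h_\mu(\alpha_m)=h(\alpha_m,g,\mu)$ ($g\in G$ arbitrary), be the reduced Hamiltonian. A horizontal solution of the Hamilton–Jacobi problem for a function on a cotangent bundle is a Lagrangian submanifold that is the image of a smooth $1$-form and along which the function is constant. A generating function of a subset $L$ of the cotangent bundle of a manifold $N$ is a smooth $S:N\to\mathbb R$ with $L=\operatorname{Im}(dS)$. Let $\tilde L\subset T^*M$ be a horizontal solution of the Hamilton–Jacobi problem for $\tilde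 h_\mu$ with generating function $S_M:M\to\mathbb R$. Let $S_G:G\to\mathbb R$ be a generating function of the $1$-form on $G$ determined by $\mu$, that is, $S_G$ is smooth and $dS_G(g)=\mu\circ T_gL_{g^{-1}}$ for all $g\in G$. Let $$L=\{\alpha_{(m,g)}\in T^*(M\times G)\;:\;J(\alpha_{(m,g)})=\mu,\ \alpha_{(m,g)}|_{T_mM\times\{0\}}\in\tilde L\}$$ be the subset reconstructed from $\tilde L$. Then $L$ is a horizontal solution of the Hamilton–Jacobi problem for $h$, and a function $S_{M\times G}:M\times G\to\mathbb R$ is a generating function of $L$ if and only if $$S_{M\times G}(m,g)=S_M(m)+S_G(g)+c(m,g)\qquad\text{for all }(m,g)\in M\times G,$$ where $c$ is constant on each connected component of $M\times G$. -/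

import Mathlib

open scoped Manifold ContDiff

noncomputable section

namespace HJReduction

section General

variable {E : Type*} [NormedAddCommGroup E] [NormedSpace ℝ E]
  {H : Type*} [TopologicalSpace H] (I : ModelWithCorners ℝ E H)
  {Q : Type*} [TopologicalSpace Q] [ChartedSpace H Q]

/-- The cotangent space `T*_q Q`. -/
abbrev CotangentSpace (q : Q) : Type _ :=
  TangentSpace I q →L[ℝ] Bundle.Trivial Q ℝ q

variable (Q) in
/-- The cotangent bundle `T*Q`, i.e. pairs `⟨q, α⟩` with `α` a covector at `q`, with Mathlib's
topology and charts of the bundle of homomorphisms from `TQ` to the trivial line bundle. -/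
abbrev CotangentBundle : Type _ :=
  Bundle.TotalSpace (E →L[ℝ] ℝ) (fun q : Q => CotangentSpace I q)

/-- The model with corners of `T*Q`. -/
abbrev cotangentModel : ModelWithCorners ℝ (E × (E →L[ℝ] ℝ)) (ModelProd H (E →L[ℝ] ℝ)) :=
  I.prod 𝓘(ℝ, E →L[ℝ] ℝ)

/-- A 1-form on `Q`, i.e. a (not necessarily smooth) choice of a covector at every point. -/
abbrev OneForm (Q : Type*) [TopologicalSpace Q] [ChartedSpace H Q] : Type _ :=
  (q : Q) → CotangentSpace I q

variable {I}

/-- The 1-form `γ` as a section `Q → T*Q` of the cotangent bundle. -/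
def OneForm.toSection (γ : OneForm I Q) : Q → CotangentBundle I Q := fun q => ⟨q, γ q⟩

/-- The 1-form `dS` on `Q`. -/
def differential (I : ModelWithCorners ℝ E H) (S : Q → ℝ) : OneForm I Q :=
  fun q => mvfderiv I S q

/-- The local expression `∑ γᵢ dxⁱ` of `γ` in the preferred chart at `x₀`: at the point `y` of the
chart's target it is the pullback of `γ` by the inverse of the chart. -/
def OneForm.inChart (γ : OneForm I Q) (x₀ : Q) (y : E) : E →L[ℝ] ℝ :=
  (γ ((extChartAt I x₀).symm y) : TangentSpace I ((extChartAt I x₀).symm y) →L[ℝ] ℝ).comp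
    (mfderiv 𝓘(ℝ, E) I (extChartAt I x₀).symm y)

/-- `dγ = 0`: in every preferred chart of the boundaryless manifold `Q`,
`∂ᵤ γ(v) = ∂ᵥ γ(u)` for all constant vectors `u`, `v`. -/
def OneForm.IsClosed (γ : OneForm I Q) : Prop :=
  ∀ x₀ : Q, ∀ y ∈ (extChartAt I x₀).target, ∀ u v : E,
    fderiv ℝ (γ.inChart x₀) y u v = fderiv ℝ (γ.inChart x₀) y v u

variable [IsManifold I ∞ Q]

/-- The 1-form `γ` is `C^∞`, as a section of the cotangent bundle. -/
def OneForm.IsSmooth (γ : OneForm I Q) : Prop :=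
  ContMDiff I (cotangentModel I) ∞ γ.toSection

/-- The canonical (Liouville) 1-form `θ_Q` of `T*Q`: `θ_Q(α)(w) = α(Tπ_Q(w))`, where
`π_Q : T*Q → Q` is the projection. The canonical symplectic form is `ω_Q = -dθ_Q`. -/
def liouvilleForm : OneForm (cotangentModel I) (CotangentBundle I Q) := fun α =>
  (α.2 : TangentSpace I α.proj →L[ℝ] ℝ).comp
    (mfderiv (cotangentModel I) I
      (Bundle.TotalSpace.proj : CotangentBundle I Q → Q) α)

/-- The pullback `γ^* θ_Q` of the canonical 1-form by the section `γ : Q → T*Q`, i.e. the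
restriction of `θ_Q` to the submanifold `Im γ`, parametrised by `γ`. -/
def OneForm.pullbackLiouville (γ : OneForm I Q) : OneForm I Q := fun q =>
  (liouvilleForm (I := I) (γ.toSection q) :
      TangentSpace (cotangentModel I) (γ.toSection q) →L[ℝ] ℝ).comp
    (mfderiv I (cotangentModel I) γ.toSection q)

/-- `L ⊆ T*Q` is a horizontal Lagrangian submanifold: it is the image of a smooth 1-form `γ` (hence
an embedded submanifold of dimension `dim Q`) and `ω_Q = -dθ_Q` vanishes on it, i.e. the
restriction of `θ_Q` to it is closed. -/
def IsHorizontalLagrangian (L : Set (CotangentBundle I Q)) : Prop :=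
  ∃ γ : OneForm I Q, γ.IsSmooth ∧ L = Set.range γ.toSection ∧ γ.pullbackLiouville.IsClosed

/-- `L` is a horizontal solution of the (time-independent) Hamilton-Jacobi problem for the
Hamiltonian `h`: a horizontal Lagrangian submanifold along which `h` is constant. -/
def IsHorizontalHJSolution (h : CotangentBundle I Q → ℝ) (L : Set (CotangentBundle I Q)) :
    Prop :=
  IsHorizontalLagrangian L ∧ ∃ e : ℝ, ∀ α ∈ L, h α = e

/-- The smooth function `S : Q → ℝ` is a generating function of `L ⊆ T*Q`: `L = Im (dS)`. -/
def IsGeneratingFunction (S : Q → ℝ) (L : Set (CotangentBundle I Q)) : Prop :=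
  ContMDiff I 𝓘(ℝ) ∞ S ∧ L = Set.range (differential I S).toSection

end General

section LieGroupPart

variable {F : Type*} [NormedAddCommGroup F] [NormedSpace ℝ F]
  {K : Type*} [TopologicalSpace K] {J : ModelWithCorners ℝ F K}
  {G : Type*} [TopologicalSpace G] [ChartedSpace K G] [Group G]

variable (J G) in
/-- The dual `𝔤*` of the Lie algebra `𝔤 = T_1 G`. -/
abbrev DualLieAlgebra : Type _ := GroupLieAlgebra J G →L[ℝ] ℝ

/-- The differential `T_1 G → T_1 G` at `1` of `k ↦ g⁻¹ * k * g = R_g (L_{g⁻¹} k)`. -/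
def conjDifferential (J : ModelWithCorners ℝ F K) (g : G) :
    GroupLieAlgebra J G →L[ℝ] GroupLieAlgebra J G :=
  mfderiv J J (fun k : G => g⁻¹ * k * g) (1 : G)

/-- The coadjoint action `Ad*_g μ = μ ∘ TR_g ∘ TL_{g⁻¹}` of `G` on `𝔤*`. -/
def coadjoint (g : G) (μ : DualLieAlgebra J G) : DualLieAlgebra J G :=
  μ.comp (conjDifferential J g)

/-- The differential `T_g G → T_1 G` at `g` of the left translation by `g⁻¹`, which is the left
trivialisation of `TG`. -/
def leftTrivialization (J : ModelWithCorners ℝ F K) (g : G) :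
    TangentSpace J g →L[ℝ] GroupLieAlgebra J G :=
  mfderiv J J (fun k : G => g⁻¹ * k) g

/-- `μ ∈ 𝔤*` viewed as a 1-form on `G`, namely the section `g ↦ (g, μ)` of
`G × 𝔤* → G` in the left trivialisation `T*G = G × 𝔤*`. -/
def leftInvariantForm (μ : DualLieAlgebra J G) : OneForm J G :=
  fun g => μ.comp (leftTrivialization J g)

end LieGroupPart

section Product

variable {E : Type*} [NormedAddCommGroup E] [NormedSpace ℝ E]
  {H : Type*} [TopologicalSpace H] {I : ModelWithCorners ℝ E H}
  {M : Type*} [TopologicalSpace M] [ChartedSpace H M]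
  {F : Type*} [NormedAddCommGroup F] [NormedSpace ℝ F]
  {K : Type*} [TopologicalSpace K] {J : ModelWithCorners ℝ F K}
  {G : Type*} [TopologicalSpace G] [ChartedSpace K G] [Group G]

/-- The action `Φ_g (m, k) = (m, g * k)` of `G` on `M × G`. -/
def action (g : G) (q : M × G) : M × G := (q.1, g * q.2)

/-- The differential `T_{gq} (M × G) → T_q (M × G)` of `Φ_{g⁻¹}` at `Φ_g q`. -/
def actionInvDifferential (I : ModelWithCorners ℝ E H) (J : ModelWithCorners ℝ F K)
    (g : G) (q : M × G) :
    TangentSpace (I.prod J) (action g q) →L[ℝ] TangentSpace (I.prod J) q :=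
  mfderiv (I.prod J) (I.prod J) (action g⁻¹ : M × G → M × G) (action g q)

/-- The lifted action on `T*(M × G)`: `Φ^{T*}_g (α_q) = α_q ∘ TΦ_{g⁻¹}(gq)`. -/
def cotangentAction (g : G) (α : CotangentBundle (I.prod J) (M × G)) :
    CotangentBundle (I.prod J) (M × G) :=
  ⟨action g α.proj,
    (α.2 : TangentSpace (I.prod J) α.proj →L[ℝ] ℝ).comp (actionInvDifferential I J g α.proj)⟩

/-- The infinitesimal generator `ξ ↦ ξ_Q(q)`: the differential at `1` of the orbit map
`g ↦ Φ_g q`. -/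
def infinitesimalGenerator (I : ModelWithCorners ℝ E H) (J : ModelWithCorners ℝ F K)
    (q : M × G) : GroupLieAlgebra J G →L[ℝ] TangentSpace (I.prod J) q :=
  mfderiv J (I.prod J) (fun g : G => action g q) (1 : G)

/-- The momentum map `J : T*(M × G) → 𝔤*`, `J(α_q)(ξ) = α_q(ξ_Q(q))`. -/
def momentumMap (α : CotangentBundle (I.prod J) (M × G)) : DualLieAlgebra J G :=
  (α.2 : TangentSpace (I.prod J) α.proj →L[ℝ] ℝ).comp (infinitesimalGenerator I J α.proj)

/-- The covector `α_q ∘ 𝐡 ∈ T*_m M`, for `q = (m, g)`, where `𝐡 : T_m M → T_q (M × G)` is the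
horizontal lift of the trivial connection of `M × G → M = (M × G)/G`, i.e. the differential of
`m' ↦ (m', g)`. -/
def horizontalPart (α : CotangentBundle (I.prod J) (M × G)) : CotangentBundle I M :=
  ⟨α.proj.1, (α.2 : TangentSpace (I.prod J) α.proj →L[ℝ] ℝ).comp
    (mfderiv I (I.prod J) (fun m : M => (m, α.proj.2)) α.proj.1)⟩

/-- The point `(α_m, g, μ)` of `T*M × G × 𝔤* = T*(M × G)`, where `T*G = G × 𝔤*` is
trivialised on the left. -/
def trivializedPoint (α : CotangentBundle I M) (g : G) (μ : DualLieAlgebra J G) :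
    CotangentBundle (I.prod J) (M × G) :=
  ⟨(α.proj, g),
    (α.2 : TangentSpace I α.proj →L[ℝ] ℝ).comp
        (mfderiv (I.prod J) I (Prod.fst : M × G → M) (α.proj, g)) +
      (μ.comp (leftTrivialization J g)).comp
        (mfderiv (I.prod J) J (Prod.snd : M × G → G) (α.proj, g))⟩

/-- `h` is invariant under the lifted action of `G` on `T*(M × G)`. -/
def IsInvariantHamiltonian (h : CotangentBundle (I.prod J) (M × G) → ℝ) : Prop :=
  ∀ (g : G) (α : CotangentBundle (I.prod J) (M × G)), h (cotangentAction g α) = h α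

/-- The reduced Hamiltonian `h̃_μ(α_m) = h(α_m, g, μ)` on `T*M`. For an invariant `h` the choice
of `g` is immaterial; we take `g = 1`. -/
def reducedHamiltonian (h : CotangentBundle (I.prod J) (M × G) → ℝ) (μ : DualLieAlgebra J G) :
    CotangentBundle I M → ℝ :=
  fun α => h (trivializedPoint α (1 : G) μ)

/-- The subset of `T*(M × G)` reconstructed from `L' ⊆ T*M` at the momentum `μ`: the preimage of
`L' × {μ}` under `α_q ↦ (α_q ∘ 𝐡, J(α_q))`. -/
def reconstruction (μ : DualLieAlgebra J G) (L' : Set (CotangentBundle I M)) :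
    Set (CotangentBundle (I.prod J) (M × G)) :=
  {α | horizontalPart α ∈ L' ∧ momentumMap α = μ}

end Product

end HJReduction

end

namespace HJReduction

/-! ### Exact 1-forms: Lagrangian images and uniqueness of primitives -/

section General

variable {E : Type*} [NormedAddCommGroup E] [NormedSpace ℝ E]
  {H : Type*} [TopologicalSpace H] {I : ModelWithCorners ℝ E H}
  {Q : Type*} [TopologicalSpace Q] [ChartedSpace H Q]

/-! Everything reduces to the identity L = Im d(S_M + S_G). A covector at (m, g) is determined by
its restrictions to T_m M and T_g G. Membership in L fixes the first as dS_M(m). The momentum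
condition fixes the pullback of the second by right translation; since μ is coadjoint-fixed, this
says that the second is the left-invariant form of μ at g, which is dS_G(g). This is
`reconstruction_range_differential`. The image of an exact form is Lagrangian because the Liouville
form pulls back to the form itself and d² = 0. By invariance, h at the point of L over (m, g) equals
the reduced Hamiltonian at dS_M(m), hence is constant. Finally, the image of a 1-form determines the
form, and two functions have equal differentials exactly when they differ by a constant on each
component. -/

theorem CotangentBundle.mk_eq_mk {q q' : Q} (hq : q = q') (a : CotangentSpace I q)
    (b : CotangentSpace I q') (hab : ∀ v : E, (a : E →L[ℝ] ℝ) v = (b : E →L[ℝ] ℝ) v) :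
    (⟨q, a⟩ : CotangentBundle I Q) = ⟨q', b⟩ := by
  subst hq
  congr 1
  ext v
  exact hab v

theorem OneForm.mem_range_toSection {γ : OneForm I Q} {α : CotangentBundle I Q} :
    α ∈ Set.range γ.toSection ↔ α.2 = γ α.proj := by
  constructor
  · rintro ⟨q, rfl⟩
    rfl
  · intro h
    exact ⟨α.proj, by rw [OneForm.toSection, ← h]⟩

theorem OneForm.range_toSection_injective {γ γ' : OneForm I Q}
    (h : Set.range γ.toSection = Set.range γ'.toSection) : γ = γ' := by
  funext q
  have hq : γ.toSection q ∈ Set.range γ'.toSection := h ▸ Set.mem_range_self q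
  exact OneForm.mem_range_toSection.1 hq

variable (I Q) in
theorem locallyConnectedSpace_of_boundaryless [I.Boundaryless] : LocallyConnectedSpace Q :=
  have : LocallyConnectedSpace H := I.toHomeomorph.isOpenEmbedding.locallyConnectedSpace
  ChartedSpace.locallyConnectedSpace H Q

theorem contMDiff_of_isLocallyConstant {f : Q → ℝ} (hf : IsLocallyConstant f) :
    ContMDiff I 𝓘(ℝ) ∞ f := fun x =>
  contMDiffAt_const.congr_of_eventuallyEq (hf.eventually_eq x)

theorem differential_of_isLocallyConstant {f : Q → ℝ} (hf : IsLocallyConstant f) :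
    differential I f = 0 := by
  funext x
  have he : f =ᶠ[nhds x] fun _ => f x := hf.eventually_eq x
  have h := he.mfderiv_eq (I := I) (I' := 𝓘(ℝ))
  rw [mfderiv_const] at h
  ext v
  exact DFunLike.congr_fun h v

variable [IsManifold I ∞ Q]

theorem differential_isSmooth {S : Q → ℝ} (hS : ContMDiff I 𝓘(ℝ) ∞ S) :
    (differential I S).IsSmooth := by
  intro q
  refine (contMDiffAt_hom_bundle _).2 ⟨contMDiffAt_id, ?_⟩
  refine (ContMDiffAt.mfderiv_const (hS q) (m := ∞) (by simp)).congr_of_eventuallyEq ?_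
  refine Filter.Eventually.of_forall fun x => ?_
  ext v
  simp [inTangentCoordinates, ContinuousLinearMap.inCoordinates, OneForm.toSection, differential,
    mvfderiv]
  rfl

/-- The tautological property of the Liouville form: differentiate π ∘ γ = id. It turns the
Lagrangian condition into closedness of γ. -/
theorem OneForm.IsSmooth.pullbackLiouville_eq {γ : OneForm I Q} (hγ : γ.IsSmooth) :
    γ.pullbackLiouville = γ := by
  funext q
  have h1 : MDifferentiableAt I (cotangentModel I) γ.toSection q :=
    (hγ q).mdifferentiableAt (by simp)
  have h2 : MDifferentiableAt (cotangentModel I) I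
      (Bundle.TotalSpace.proj : CotangentBundle I Q → Q) (γ.toSection q) :=
    (Bundle.contMDiff_proj (n := ∞) _ _).mdifferentiableAt (by simp)
  have h3 := mfderiv_comp q h2 h1
  have h4 : (Bundle.TotalSpace.proj : CotangentBundle I Q → Q) ∘ γ.toSection = id := rfl
  rw [h4, mfderiv_id] at h3
  ext v
  have h5 := DFunLike.congr_fun h3 v
  exact congrArg (γ q) h5.symm

theorem differential_inChart [I.Boundaryless] {S : Q → ℝ} (hS : ContMDiff I 𝓘(ℝ) ∞ S) (x₀ : Q)
    {y : E} (hy : y ∈ (extChartAt I x₀).target) :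
    (differential I S).inChart x₀ y = fderiv ℝ (S ∘ (extChartAt I x₀).symm) y := by
  have h1 : MDifferentiableAt I 𝓘(ℝ) S ((extChartAt I x₀).symm y) :=
    (hS _).mdifferentiableAt (by simp)
  have h2 : MDifferentiableAt 𝓘(ℝ, E) I (extChartAt I x₀).symm y :=
    ((contMDiffOn_extChartAt_symm (n := ∞) x₀).contMDiffAt
      ((isOpen_extChartAt_target x₀).mem_nhds hy)).mdifferentiableAt (by simp)
  have h3 := mfderiv_comp y h1 h2
  rw [mfderiv_eq_fderiv] at h3
  exact h3.symm

theorem contDiffOn_comp_extChartAt_symm {S : Q → ℝ}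
    (hS : ContMDiff I 𝓘(ℝ) ∞ S) (x₀ : Q) :
    ContDiffOn ℝ ∞ (S ∘ (extChartAt I x₀).symm) (extChartAt I x₀).target :=
  (hS.comp_contMDiffOn (contMDiffOn_extChartAt_symm (n := ∞) x₀)).contDiffOn

/-- In a chart this is the symmetry of second derivatives. -/
theorem differential_isClosed [I.Boundaryless] {S : Q → ℝ} (hS : ContMDiff I 𝓘(ℝ) ∞ S) :
    (differential I S).IsClosed := by
  intro x₀ y hy u v
  have hopen : (extChartAt I x₀).target ∈ nhds y := (isOpen_extChartAt_target x₀).mem_nhds hy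
  have h1 : (differential I S).inChart x₀ =ᶠ[nhds y] fderiv ℝ (S ∘ (extChartAt I x₀).symm) := by
    filter_upwards [hopen] with z hz using differential_inChart hS x₀ hz
  rw [h1.fderiv_eq]
  have h2 : ContDiffAt ℝ ∞ (S ∘ (extChartAt I x₀).symm) y :=
    (contDiffOn_comp_extChartAt_symm hS x₀).contDiffAt hopen
  exact h2.isSymmSndFDerivAt (by simpa using ENat.LEInfty.out) u v

theorem isHorizontalLagrangian_range_differential [I.Boundaryless] {S : Q → ℝ}
    (hS : ContMDiff I 𝓘(ℝ) ∞ S) :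
    IsHorizontalLagrangian (Set.range (differential I S).toSection) := by
  refine ⟨differential I S, differential_isSmooth hS, rfl, ?_⟩
  rw [(differential_isSmooth hS).pullbackLiouville_eq]
  exact differential_isClosed hS

theorem isLocallyConstant_of_differential_eq_zero [I.Boundaryless] {S : Q → ℝ}
    (hS : ContMDiff I 𝓘(ℝ) ∞ S) (h0 : differential I S = 0) : IsLocallyConstant S := by
  rw [IsLocallyConstant.iff_eventually_eq]
  intro x₀
  -- A ball in the chart is connected, so a vanishing derivative there forces constancy.
  obtain ⟨r, hr, hball⟩ := Metric.isOpen_iff.1 (isOpen_extChartAt_target (I := I) x₀)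
    (extChartAt I x₀ x₀) (mem_extChartAt_target x₀)
  have hd : DifferentiableOn ℝ (S ∘ (extChartAt I x₀).symm)
      (Metric.ball (extChartAt I x₀ x₀) r) :=
    ((contDiffOn_comp_extChartAt_symm hS x₀).mono hball).differentiableOn (by simp)
  have hz : Set.EqOn (fderiv ℝ (S ∘ (extChartAt I x₀).symm)) 0
      (Metric.ball (extChartAt I x₀ x₀) r) := by
    intro y hy
    rw [← differential_inChart hS x₀ (hball hy), h0]
    rfl
  filter_upwards [extChartAt_source_mem_nhds (I := I) x₀,
    (continuousAt_extChartAt (I := I) x₀).preimage_mem_nhds (Metric.ball_mem_nhds _ hr)]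
    with x hx hxb
  have := Metric.isOpen_ball.is_const_of_fderiv_eq_zero
    (convex_ball _ _).isPreconnected hd hz hxb (Metric.mem_ball_self hr)
  rwa [Function.comp_apply, Function.comp_apply, (extChartAt I x₀).left_inv hx,
    (extChartAt I x₀).left_inv (mem_extChartAt_source x₀)] at this

theorem exists_eq_comp_connectedComponents {X Y : Type*} [TopologicalSpace X]
    {f : X → Y} (hf : IsLocallyConstant f) :
    ∃ c : ConnectedComponents X → Y, ∀ x, f x = c (ConnectedComponents.mk x) := by
  refine ⟨Quotient.lift f fun x y hxy => ?_, fun x => rfl⟩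
  have hxy' : connectedComponent x = connectedComponent y := hxy
  exact hf.apply_eq_of_isPreconnected isPreconnected_connectedComponent mem_connectedComponent
    (hxy' ▸ mem_connectedComponent)

/-- Local connectedness makes the components open. -/
theorem isLocallyConstant_comp_connectedComponents {X Y : Type*} [TopologicalSpace X]
    [LocallyConnectedSpace X] (c : ConnectedComponents X → Y) :
    IsLocallyConstant fun x : X => c (ConnectedComponents.mk x) := by
  rw [IsLocallyConstant.iff_eventually_eq]
  intro x
  filter_upwards [isOpen_connectedComponent.mem_nhds (mem_connectedComponent (x := x))] with y hy
  rw [ConnectedComponents.coe_eq_coe'.2 hy]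

theorem differential_eq_iff [I.Boundaryless] {S S₀ : Q → ℝ} (hS₀ : ContMDiff I 𝓘(ℝ) ∞ S₀) :
    (ContMDiff I 𝓘(ℝ) ∞ S ∧ differential I S = differential I S₀) ↔
      ∃ c : ConnectedComponents Q → ℝ, ∀ q, S q = S₀ q + c (ConnectedComponents.mk q) := by
  constructor
  · rintro ⟨hS, hd⟩
    have h0 : differential I (S - S₀) = 0 := by
      funext q
      have h := mvfderiv_sub (I := I) ((hS q).mdifferentiableAt (by simp))
        ((hS₀ q).mdifferentiableAt (by simp))
      have hq : mvfderiv I S q = mvfderiv I S₀ q := congrFun hd q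
      rw [hq, sub_self] at h
      exact h
    obtain ⟨c, hc⟩ := exists_eq_comp_connectedComponents
      (isLocallyConstant_of_differential_eq_zero (hS.sub hS₀) h0)
    exact ⟨c, fun q => by rw [← hc]; simp⟩
  · rintro ⟨c, hc⟩
    have := locallyConnectedSpace_of_boundaryless I Q
    have hlc := isLocallyConstant_comp_connectedComponents c
    have hcs := contMDiff_of_isLocallyConstant (I := I) hlc
    obtain rfl : S = S₀ + fun q => c (ConnectedComponents.mk q) := funext hc
    refine ⟨hS₀.add hcs, ?_⟩
    funext q
    have h := mvfderiv_add (I := I) ((hS₀ q).mdifferentiableAt (by simp))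
        ((hcs q).mdifferentiableAt (by simp))
    have hz := congrFun (differential_of_isLocallyConstant (I := I) hlc) q
    exact h.trans ((congrArg _ hz).trans (add_zero _))

theorem isGeneratingFunction_range_differential_iff [I.Boundaryless] {S S₀ : Q → ℝ}
    (hS₀ : ContMDiff I 𝓘(ℝ) ∞ S₀) :
    IsGeneratingFunction S (Set.range (differential I S₀).toSection) ↔
      ∃ c : ConnectedComponents Q → ℝ, ∀ q, S q = S₀ q + c (ConnectedComponents.mk q) := by
  rw [← differential_eq_iff hS₀]
  refine and_congr_right fun _ => ⟨fun h => (OneForm.range_toSection_injective h).symm,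
    fun h => by rw [h]⟩

end General

end HJReduction

namespace HJReduction

/-! ### Chain rule and covectors on a product -/

section General

/-- The intermediate point `y` is free, since equalities such as 1 * g = g are not definitional. -/
theorem mfderiv_comp_apply_at {E E' E'' H H' H'' M M' M'' : Type*}
    [NormedAddCommGroup E] [NormedSpace ℝ E] [TopologicalSpace H] {I : ModelWithCorners ℝ E H}
    [NormedAddCommGroup E'] [NormedSpace ℝ E'] [TopologicalSpace H'] {I' : ModelWithCorners ℝ E' H'}
    [NormedAddCommGroup E''] [NormedSpace ℝ E''] [TopologicalSpace H'']
    {I'' : ModelWithCorners ℝ E'' H''}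
    [TopologicalSpace M] [ChartedSpace H M] [TopologicalSpace M'] [ChartedSpace H' M']
    [TopologicalSpace M''] [ChartedSpace H'' M'']
    {g : M' → M''} {f : M → M'} {x : M} {y : M'} (hg : MDifferentiableAt I' I'' g y)
    (hf : MDifferentiableAt I I' f x) (hy : f x = y) (v : E) :
    (mfderiv I' I'' g y : E' →L[ℝ] E'') ((mfderiv I I' f x : E →L[ℝ] E') v) =
      (mfderiv I I'' (g ∘ f) x : E →L[ℝ] E'') v := by
  subst hy
  exact (DFunLike.congr_fun (mfderiv_comp x hg hf) v).symm

theorem forall_prod_apply_eq_iff {E F : Type*} [NormedAddCommGroup E] [NormedSpace ℝ E]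
    [NormedAddCommGroup F] [NormedSpace ℝ F] (a : E × F →L[ℝ] ℝ) (b : E →L[ℝ] ℝ)
    (c : F →L[ℝ] ℝ) :
    ((∀ u, a (u, 0) = b u) ∧ ∀ v, a (0, v) = c v) ↔ ∀ w : E × F, a w = b w.1 + c w.2 := by
  refine ⟨fun ⟨h1, h2⟩ w => ?_, fun h => ⟨fun u => ?_, fun v => ?_⟩⟩
  · rw [← h1, ← h2, ← map_add, Prod.mk_add_mk, add_zero, zero_add]
  · rw [h, map_zero, add_zero]
  · rw [h, map_zero, zero_add]

end General

/-! ### Left and right translations; coadjoint-fixed momenta -/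

section LieGroupPart

variable {F : Type*} [NormedAddCommGroup F] [NormedSpace ℝ F]
  {K : Type*} [TopologicalSpace K] {J : ModelWithCorners ℝ F K}
  {G : Type*} [TopologicalSpace G] [ChartedSpace K G] [Group G] [LieGroup J ∞ G]

theorem mdifferentiableAt_mul_left (a x : G) :
    MDifferentiableAt J J (fun k : G => a * k) x :=
  ((contMDiff_mul_left (I := J) (n := ∞) (a := a)) x).mdifferentiableAt (by simp)

theorem mdifferentiableAt_mul_right (a x : G) :
    MDifferentiableAt J J (fun k : G => k * a) x :=
  ((contMDiff_mul_right (I := J) (n := ∞) (a := a)) x).mdifferentiableAt (by simp)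

/-- The differential `T_1 G → T_g G` of the right translation by `g`. -/
noncomputable def rightTranslationDifferential (J : ModelWithCorners ℝ F K) (g : G) : F →L[ℝ] F :=
  mfderiv J J (fun k : G => k * g) (1 : G)

theorem leftTrivialization_rightTranslation (g : G) (ξ : F) :
    (leftTrivialization J g : F →L[ℝ] F) (rightTranslationDifferential J g ξ) =
      (conjDifferential J g : F →L[ℝ] F) ξ := by
  have h := mfderiv_comp_apply_at (I := J) (I' := J) (I'' := J) (x := (1 : G)) (y := g)
    (g := fun k : G => g⁻¹ * k) (f := fun k : G => k * g)
    (mdifferentiableAt_mul_left _ _) (mdifferentiableAt_mul_right _ _) (one_mul g) ξ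
  have hf : (fun k : G => g⁻¹ * k) ∘ (fun k : G => k * g) = fun k => g⁻¹ * k * g :=
    funext fun k => (mul_assoc _ _ _).symm
  rw [hf] at h
  exact h

theorem rightTranslationDifferential_surjective (g : G) :
    Function.Surjective (rightTranslationDifferential J g) := by
  intro v
  refine ⟨(mfderiv J J (fun k : G => k * g⁻¹) g : F →L[ℝ] F) v, ?_⟩
  have h := mfderiv_comp_apply_at (I := J) (I' := J) (I'' := J) (x := g) (y := (1 : G))
    (g := fun k : G => k * g) (f := fun k : G => k * g⁻¹)
    (mdifferentiableAt_mul_right _ _) (mdifferentiableAt_mul_right _ _) (mul_inv_cancel g) v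
  have hf : (fun k : G => k * g) ∘ (fun k : G => k * g⁻¹) = id := funext fun k => by simp
  rw [hf, mfderiv_id] at h
  exact h

theorem leftTrivialization_one_leftTranslation {g x : G} (hx : x = g) (v : F) :
    (leftTrivialization J (1 : G) : F →L[ℝ] F)
        ((mfderiv J J (fun k : G => g⁻¹ * k) x : F →L[ℝ] F) v) =
      (leftTrivialization J g : F →L[ℝ] F) v := by
  subst hx
  have h := mfderiv_comp_apply_at (I := J) (I' := J) (I'' := J) (x := x) (y := (1 : G))
    (g := fun k : G => (1 : G)⁻¹ * k) (f := fun k : G => x⁻¹ * k)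
    (mdifferentiableAt_mul_left _ _) (mdifferentiableAt_mul_left _ _) (inv_mul_cancel x) v
  have hf : (fun k : G => (1 : G)⁻¹ * k) ∘ (fun k : G => x⁻¹ * k) = fun k => x⁻¹ * k :=
    funext fun k => by simp
  rw [hf] at h
  exact h

/-- A covector at `g` whose pullback along the right translation by `g` is a fixed point `μ` of
the coadjoint action is the value at `g` of the left-invariant form `μ`. -/
theorem comp_rightTranslation_eq_iff {μ : DualLieAlgebra J G} (hμ : ∀ g : G, coadjoint g μ = μ)
    (g : G) (b : F →L[ℝ] ℝ) :
    (∀ ξ : F, b (rightTranslationDifferential J g ξ) = (μ : F →L[ℝ] ℝ) ξ) ↔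
      ∀ v : F, b v = (leftInvariantForm μ g : F →L[ℝ] ℝ) v := by
  -- Right translation to g followed by left translation back to 1 is conjugation, so the pullback
  -- is the coadjoint action on μ.
  have key (ξ : F) : (leftInvariantForm μ g : F →L[ℝ] ℝ) (rightTranslationDifferential J g ξ) =
      (μ : F →L[ℝ] ℝ) ξ := by
    have h1 := DFunLike.congr_fun (hμ g) ξ
    exact (congrArg (μ : F →L[ℝ] ℝ) (leftTrivialization_rightTranslation g ξ)).trans h1
  constructor
  · intro h v
    obtain ⟨ξ, rfl⟩ := rightTranslationDifferential_surjective (J := J) g v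
    rw [h, key]
  · intro h ξ
    rw [h, key]

end LieGroupPart

/-! ### The lifted action and reconstruction on M × G -/

section Product

variable {E : Type*} [NormedAddCommGroup E] [NormedSpace ℝ E]
  {H : Type*} [TopologicalSpace H] {I : ModelWithCorners ℝ E H}
  {M : Type*} [TopologicalSpace M] [ChartedSpace H M]
  {F : Type*} [NormedAddCommGroup F] [NormedSpace ℝ F]
  {K : Type*} [TopologicalSpace K] {J : ModelWithCorners ℝ F K}
  {G : Type*} [TopologicalSpace G] [ChartedSpace K G]

theorem contMDiff_add_prod {S_M : M → ℝ} {S_G : G → ℝ} (hM : ContMDiff I 𝓘(ℝ) ∞ S_M)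
    (hG : ContMDiff J 𝓘(ℝ) ∞ S_G) :
    ContMDiff (I.prod J) 𝓘(ℝ) ∞ fun q : M × G => S_M q.1 + S_G q.2 :=
  (hM.comp contMDiff_fst).add (hG.comp contMDiff_snd)

theorem differential_add_prod {S_M : M → ℝ} {S_G : G → ℝ} (hM : ContMDiff I 𝓘(ℝ) ∞ S_M)
    (hG : ContMDiff J 𝓘(ℝ) ∞ S_G) (q : M × G) (v : E × F) :
    (differential (I.prod J) (fun q : M × G => S_M q.1 + S_G q.2) q : E × F →L[ℝ] ℝ) v =
      (differential I S_M q.1 : E →L[ℝ] ℝ) v.1 + (differential J S_G q.2 : F →L[ℝ] ℝ) v.2 := by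
  have h1 : HasMFDerivAt I 𝓘(ℝ) S_M q.1 (mfderiv I 𝓘(ℝ) S_M q.1) :=
    ((hM q.1).mdifferentiableAt (by simp)).hasMFDerivAt
  have h2 : HasMFDerivAt J 𝓘(ℝ) S_G q.2 (mfderiv J 𝓘(ℝ) S_G q.2) :=
    ((hG q.2).mdifferentiableAt (by simp)).hasMFDerivAt
  have h := (h1.comp q (hasMFDerivAt_fst (I := I) (I' := J) q)).add
    (h2.comp q (hasMFDerivAt_snd (I := I) (I' := J) q))
  exact DFunLike.congr_fun h.mfderiv v

theorem horizontalPart_apply (α : CotangentBundle (I.prod J) (M × G)) (u : E) :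
    ((horizontalPart α).2 : E →L[ℝ] ℝ) u = (α.2 : E × F →L[ℝ] ℝ) (u, 0) := by
  have h := mfderiv_prod_left (I := I) (I' := J) (x₀ := α.proj.1) (y₀ := α.proj.2)
  exact congrArg (α.2 : E × F →L[ℝ] ℝ) (DFunLike.congr_fun h u)

variable [Group G]

theorem trivializedPoint_apply (a : CotangentBundle I M) (g : G) (μ : DualLieAlgebra J G)
    (v : E × F) :
    ((trivializedPoint a g μ : CotangentBundle (I.prod J) (M × G)).2 : E × F →L[ℝ] ℝ) v =
      (a.2 : E →L[ℝ] ℝ) v.1 + (leftInvariantForm μ g : F →L[ℝ] ℝ) v.2 := by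
  have h1 := DFunLike.congr_fun (mfderiv_fst (I := I) (I' := J) (x := (a.proj, g))) v
  have h2 := DFunLike.congr_fun (mfderiv_snd (I := I) (I' := J) (x := (a.proj, g))) v
  exact congrArg₂ (· + ·) (congrArg (a.2 : E →L[ℝ] ℝ) h1)
    (congrArg (leftInvariantForm μ g : F →L[ℝ] ℝ) h2)

variable {μ : DualLieAlgebra J G} {S_M : M → ℝ} {S_G : G → ℝ}

theorem toSection_differential_add_prod (hM : ContMDiff I 𝓘(ℝ) ∞ S_M)
    (hG : ContMDiff J 𝓘(ℝ) ∞ S_G) (hd : differential J S_G = leftInvariantForm μ) (q : M × G) :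
    (differential (I.prod J) fun q : M × G => S_M q.1 + S_G q.2).toSection q =
      trivializedPoint ((differential I S_M).toSection q.1) q.2 μ := by
  refine CotangentBundle.mk_eq_mk rfl _ _ fun v => ?_
  refine (differential_add_prod hM hG q v).trans ?_
  rw [hd]
  exact (trivializedPoint_apply ((differential I S_M).toSection q.1) q.2 μ v).symm

variable [LieGroup J ∞ G]

theorem momentumMap_apply (α : CotangentBundle (I.prod J) (M × G)) (ξ : F) :
    (momentumMap α : F →L[ℝ] ℝ) ξ =
      (α.2 : E × F →L[ℝ] ℝ) (0, rightTranslationDifferential J α.proj.2 ξ) := by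
  have h1 := mfderiv_prodMk (I := J) (I' := I) (I'' := J) (x := (1 : G))
    (f := fun _ : G => α.proj.1) (g := fun k : G => k * α.proj.2)
    mdifferentiableAt_const (mdifferentiableAt_mul_right _ _)
  rw [mfderiv_const] at h1
  exact congrArg (α.2 : E × F →L[ℝ] ℝ) (DFunLike.congr_fun h1 ξ)

theorem actionInvDifferential_apply (g : G) (q : M × G) (v : E × F) :
    (actionInvDifferential I J g q : E × F →L[ℝ] E × F) v =
      (v.1, (mfderiv J J (fun k : G => g⁻¹ * k) (g * q.2) : F →L[ℝ] F) v.2) := by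
  have h1 := mfderiv_prodMap (I := I) (I' := J) (J := I) (J' := J) (p := action g q)
    (f := (id : M → M)) (g := fun k : G => g⁻¹ * k)
    mdifferentiableAt_id (mdifferentiableAt_mul_left (J := J) _ _)
  rw [mfderiv_id] at h1
  exact DFunLike.congr_fun h1 v

/-- The lifted action only moves the factor `G` of `T*M × G × 𝔤*`. -/
theorem cotangentAction_trivializedPoint (g : G) (a : CotangentBundle I M)
    (μ : DualLieAlgebra J G) :
    cotangentAction g (trivializedPoint a (1 : G) μ : CotangentBundle (I.prod J) (M × G)) =
      trivializedPoint a g μ := by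
  refine CotangentBundle.mk_eq_mk (congrArg (Prod.mk a.proj) (mul_one g)) _ _ fun v => ?_
  refine Eq.trans ?_ (trivializedPoint_apply (I := I) a g μ v).symm
  refine (congrArg ((trivializedPoint a (1 : G) μ : CotangentBundle (I.prod J) (M × G)).2 :
    E × F →L[ℝ] ℝ) (actionInvDifferential_apply (I := I) (J := J) g
    ((a.proj, 1) : M × G) v)).trans ?_
  refine (trivializedPoint_apply (I := I) a (1 : G) μ _).trans ?_
  exact congrArg (fun w => (a.2 : E →L[ℝ] ℝ) v.1 + (μ : F →L[ℝ] ℝ) w)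
    (leftTrivialization_one_leftTranslation (mul_one g) v.2)

theorem IsInvariantHamiltonian.apply_trivializedPoint
    {h : CotangentBundle (I.prod J) (M × G) → ℝ} (hh : IsInvariantHamiltonian h)
    (a : CotangentBundle I M) (g : G) (μ : DualLieAlgebra J G) :
    h (trivializedPoint a g μ) = reducedHamiltonian h μ a := by
  rw [← cotangentAction_trivializedPoint, hh]
  rfl

/-- The horizontal part tests a covector on vectors (u, 0), the momentum map on vectors (0, v);
these span the tangent space. -/
theorem reconstruction_range_differential (hμ : ∀ g : G, coadjoint g μ = μ)
    (hM : ContMDiff I 𝓘(ℝ) ∞ S_M) (hG : ContMDiff J 𝓘(ℝ) ∞ S_G)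
    (hd : differential J S_G = leftInvariantForm μ) :
    reconstruction μ (Set.range (differential I S_M).toSection) =
      Set.range (differential (I.prod J) fun q : M × G => S_M q.1 + S_G q.2).toSection := by
  ext α
  have hhor : horizontalPart α ∈ Set.range (differential I S_M).toSection ↔
      ∀ u : E, (α.2 : E × F →L[ℝ] ℝ) (u, 0) = (differential I S_M α.proj.1 : E →L[ℝ] ℝ) u := by
    rw [OneForm.mem_range_toSection]
    refine Iff.trans (ContinuousLinearMap.ext_iff (M₁ := E)) (forall_congr' fun u => ?_)
    exact (horizontalPart_apply α u).congr_left
  have hmom : momentumMap α = μ ↔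
      ∀ v : F, (α.2 : E × F →L[ℝ] ℝ) (0, v) = (differential J S_G α.proj.2 : F →L[ℝ] ℝ) v := by
    rw [hd]
    -- The generators of a left action are right-invariant while the form of μ is left-invariant;
    -- coadjoint invariance reconciles them.
    refine Iff.trans ?_ (comp_rightTranslation_eq_iff hμ α.proj.2
      ((α.2 : E × F →L[ℝ] ℝ).comp (ContinuousLinearMap.inr ℝ E F)))
    refine Iff.trans (ContinuousLinearMap.ext_iff (M₁ := F)) (forall_congr' fun ξ => ?_)
    exact (momentumMap_apply α ξ).congr_left
  have hsec : α ∈ Set.range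
        (differential (I.prod J) fun q : M × G => S_M q.1 + S_G q.2).toSection ↔
      ∀ v : E × F, (α.2 : E × F →L[ℝ] ℝ) v = (differential I S_M α.proj.1 : E →L[ℝ] ℝ) v.1 +
        (differential J S_G α.proj.2 : F →L[ℝ] ℝ) v.2 := by
    rw [OneForm.mem_range_toSection]
    refine Iff.trans (ContinuousLinearMap.ext_iff (M₁ := E × F)) (forall_congr' fun v => ?_)
    exact (differential_add_prod hM hG α.proj v).congr_right
  rw [hsec]
  exact (and_congr hhor hmom).trans (forall_prod_apply_eq_iff (E := E) (F := F) _ _ _)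

end Product

end HJReduction

/-! ### The Hamilton–Jacobi reconstruction theorem -/

theorem mainTheorem5
    {E : Type*} [NormedAddCommGroup E] [NormedSpace ℝ E] [FiniteDimensional ℝ E]
    {H : Type*} [TopologicalSpace H] (I : ModelWithCorners ℝ E H) [I.Boundaryless]
    {M : Type*} [TopologicalSpace M] [ChartedSpace H M] [IsManifold I ∞ M]
    {F : Type*} [NormedAddCommGroup F] [NormedSpace ℝ F] [FiniteDimensional ℝ F]
    {K : Type*} [TopologicalSpace K] (J : ModelWithCorners ℝ F K) [J.Boundaryless]
    {G : Type*} [TopologicalSpace G] [ChartedSpace K G] [Group G] [LieGroup J ∞ G]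
    [ConnectedSpace G]
    (h : HJReduction.CotangentBundle (I.prod J) (M × G) → ℝ)
    (h_smooth : ContMDiff (HJReduction.cotangentModel (I.prod J)) 𝓘(ℝ) ∞ h)
    (h_invariant : HJReduction.IsInvariantHamiltonian h)
    (μ : HJReduction.DualLieAlgebra J G)
    (hμ : ∀ g : G, HJReduction.coadjoint g μ = μ)
    (L' : Set (HJReduction.CotangentBundle I M))
    (hL' : HJReduction.IsHorizontalHJSolution (HJReduction.reducedHamiltonian h μ) L')
    (S_M : M → ℝ) (hS_M : HJReduction.IsGeneratingFunction S_M L')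
    (S_G : G → ℝ)
    (hS_G : HJReduction.IsGeneratingFunction S_G
      (Set.range (HJReduction.leftInvariantForm μ).toSection)) :
    HJReduction.IsHorizontalHJSolution h (HJReduction.reconstruction μ L') ∧
    ∀ S : M × G → ℝ,
      HJReduction.IsGeneratingFunction S (HJReduction.reconstruction μ L') ↔
        ∃ c : ConnectedComponents (M × G) → ℝ,
          ∀ (m : M) (g : G), S (m, g) = S_M m + S_G g + c (ConnectedComponents.mk (m, g)) := by
  obtain ⟨hM, rfl⟩ := hS_M
  obtain ⟨hG, hrange⟩ := hS_G
  have hd := (HJReduction.OneForm.range_toSection_injective hrange).symm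
  have hS := HJReduction.contMDiff_add_prod hM hG
  rw [HJReduction.reconstruction_range_differential hμ hM hG hd]
  refine ⟨⟨HJReduction.isHorizontalLagrangian_range_differential hS, ?_⟩, fun S => ?_⟩
  · obtain ⟨e, he⟩ := hL'.2
    refine ⟨e, ?_⟩
    rintro _ ⟨q, rfl⟩
    -- The point of L over (m, g) is (dS_M(m), g, μ), which invariance moves to g = 1.
    rw [HJReduction.toSection_differential_add_prod hM hG hd, h_invariant.apply_trivializedPoint]
    exact he _ (Set.mem_range_self _)
  · rw [HJReduction.isGeneratingFunction_range_differential_iff hS]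
    exact exists_congr fun c => Prod.forall
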